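/- Let $n\ge 1$ and let $\mathcal{C}\subseteq\mathbb{Z}_n$ with $0\notin\mathcal{C}$; identify $\mathbb{Z}_n$ with $\{0,1,\dots,n-1\}$. The mixed circulant graph $G=\mathrm{Circ}(\mathbb{Z}_n,\mathcal{C})$ has vertex set $\mathbb{Z}_n$ and edge set $E=\{(a,b): b-a\in\mathcal{C}\}$. Its Hermitian adjacency matrix $H=(h_{uv})$ has $h_{uv}=1$ if $(u,v)\in E$ and $(v,u)\in E$; $h_{uv}=i$ if $(u,v)\in E$ and $(v,u)\notin E$; $h_{uv}=-i$ if $(u,v)\notin E$ and $(v,u)\in E$; and $h_{uv}=0$ otherwise. The graph $G$ is called integral if all eigenvalues of $H$ are integers. Put $\overline{\mathcal{C}}=\{u\in\mathcal{C}: -u\notin\mathcal{C}\}$. For $d\mid n$ let $G_n(d)=\{k: 1\le k\le n-1,\ \gcd(k,n)=d\}$, and, if $4\mid n$, for $d\mid \frac n4$ and $r\in\{1,3\}$ let $G_n^r(d)=\{dk: 0\le dk<n,\ k\equiv r \pmod 4,\ \gcd(dk,n)=d\}$. **Theorem.** $G=\mathrm{Circ}(\mathbb{Z}_n,\mathcal{C})$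 is integral if and only if there is a set $\mathscr{D}_1\subseteq\{d: d\mid n\}$ such that $\mathcal{C}\setminus\overline{\mathcal{C}}=\bigcup_{d\in\mathscr{D}_1}G_n(d)$ and - if $n\not\equiv 0\pmod 4$, then $\overline{\mathcal{C}}=\emptyset$; - if $n\equiv 0\pmod 4$, then there are a set $\mathscr{D}_2\subseteq\{d: d\mid\frac n4\}$ with $\mathscr{D}_1\cap\mathscr{D}_2=\emptyset$ and, for each $d\in\mathscr{D}_2$, a choice of $S_n(d)\in\{G_n^1(d),G_n^3(d)\}$, such that $\overline{\mathcal{C}}=\bigcup_{d\in\mathscr{D}_2}S_n(d)$. -/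

import Mathlib

/-- A mixed graph on `V`: a set of ordered pairs (edges) without loops. An edge `(u, v)` is
undirected if `(v, u)` is also an edge and directed otherwise. -/
structure MixedGraph (V : Type*) where
  Adj : V → V → Prop
  loopless : ∀ v, ¬ Adj v v

namespace MixedGraph

open Classical in
/-- The Hermitian adjacency matrix of a mixed graph. -/
noncomputable def hermitianAdjMatrix {V : Type*} (G : MixedGraph V) : Matrix V V ℂ :=
  Matrix.of fun u v =>
    if G.Adj u v ∧ G.Adj v u then 1
    else if G.Adj u v ∧ ¬ G.Adj v u then Complex.I
    else if ¬ G.Adj u v ∧ G.Adj v u then -Complex.I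
    else 0

/-- A mixed graph is integral if every eigenvalue of its Hermitian adjacency matrix is an
integer. -/
def IsIntegral {V : Type*} [Fintype V] [DecidableEq V] (G : MixedGraph V) : Prop :=
  ∀ μ : ℂ, Module.End.HasEigenvalue (Matrix.toLin' G.hermitianAdjMatrix) μ →
    ∃ z : ℤ, μ = (z : ℂ)

/-- The mixed circulant graph `Circ(ℤ_n, C)`: its edges are the pairs `(a, b)` with
`b - a ∈ C`, where `0 ∉ C`. -/
def circ (n : ℕ) (C : Set (ZMod n)) (hC : (0 : ZMod n) ∉ C) : MixedGraph (ZMod n) where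
  Adj a b := b - a ∈ C
  loopless a := by simpa using hC

end MixedGraph

/-- The skew-symmetric part of a symbol set: the elements of `C` whose inverse is not in `C`. -/
def skewPart {n : ℕ} (C : Set (ZMod n)) : Set (ZMod n) :=
  {u | u ∈ C ∧ -u ∉ C}

/-- The set `G_n(d) = {k : 1 ≤ k ≤ n - 1, gcd(k, n) = d}`, as a set of residues modulo `n`
(for `n ≠ 0`, `x.val` is the representative of `x` in `{0, …, n - 1}`). -/
def gcdClass (n d : ℕ) : Set (ZMod n) :=
  {x | 1 ≤ x.val ∧ x.val ≤ n - 1 ∧ Nat.gcd x.val n = d}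

/-- The set `G_n^r(d) = {d k : k ≡ r mod 4, gcd(d k, n) = d}`, as a set of residues modulo `n`
(it is used for `r ∈ {1, 3}` and `4 d ∣ n`, where the class of `k` modulo `4` depends only on
the residue of `d k` modulo `n`). -/
def gcdClassMod (n d r : ℕ) : Set (ZMod n) :=
  {x | ∃ k : ℕ, x.val = d * k ∧ k ≡ r [MOD 4] ∧ Nat.gcd (d * k) n = d}

/-! The eigenvalues of `H` are the Fourier coefficients `λ_j` of its first row `h`. With `ζ` a
primitive `4n`-th root of unity, `ζ ^ 4` the basic character value and `ζ ^ n = i`, they lie in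
`ℤ[ζ]`, so they are integers exactly when every `ζ ↦ ζ ^ a`, `a` coprime to `4n`, fixes them.
Reindexing the sum by `a` and injectivity of the transform turn this into `σ_a(h_k) = h_{ak}` for
all `k` (`isIntegral_circ_iff_equivariant`). As `h_{-k}` is the conjugate of `h_k`, only `a ≡ 1 (mod
4)` matters, and the condition becomes `IsUnitStable`.

The rest is a description of orbits (`isUnitStable_iff`). The symmetric part absorbs signs, hence is
a union of orbits of all units, which are the gcd classes. For a skew `x` with gcd `d`, no `a ≡ 3
(mod 4)` may fix `x`, which forces `4 ∣ n / d`. The gcd class then splits into the halves `k ≡ 1`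
and `k ≡ 3 (mod 4)`, each one orbit; negation swaps them, so the skew part contains at most one. -/

/-! ### Coprime multipliers acting on residues -/

/-- A residue coprime to a divisor of `M` lifts to a residue coprime to `M`. -/
lemma Nat.exists_coprime_modEq {L M a : ℕ} (hM : M ≠ 0) (hL : L ∣ M) (ha : a.Coprime L) :
    ∃ b : ℕ, b.Coprime M ∧ b ≡ a [MOD L] := by
  have : NeZero M := ⟨hM⟩
  obtain ⟨u, hu⟩ := ZMod.unitsMap_surjective hL (ZMod.unitOfCoprime a ha)
  refine ⟨(u : ZMod M).val, ZMod.val_coe_unit_coprime u, ?_⟩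
  rw [← ZMod.natCast_eq_natCast_iff]
  have h := congrArg (Units.val) hu
  rw [ZMod.unitsMap_def, Units.coe_map, ZMod.coe_unitOfCoprime] at h
  rw [← h, ZMod.natCast_val]
  rfl

lemma Nat.exists_coprime_mul_modEq {m M k l : ℕ} (hM : M ≠ 0) (hm : m ∣ M)
    (hk : k.Coprime m) (hl : l.Coprime m) :
    ∃ a : ℕ, a.Coprime M ∧ a * k ≡ l [MOD m] := by
  have hm0 : m ≠ 0 := fun h => hM (by simpa [h] using hm)
  have : NeZero m := ⟨hm0⟩
  set u := ZMod.unitOfCoprime l hl * (ZMod.unitOfCoprime k hk)⁻¹ with hu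
  obtain ⟨a, ha, hau⟩ := Nat.exists_coprime_modEq hM hm (ZMod.val_coe_unit_coprime u)
  refine ⟨a, ha, ?_⟩
  rw [← ZMod.natCast_eq_natCast_iff] at hau ⊢
  rw [ZMod.natCast_val, ZMod.cast_id] at hau
  have : (k : ZMod m) = (ZMod.unitOfCoprime k hk : ZMod m) := rfl
  rw [Nat.cast_mul, hau, this, ← Units.val_mul, hu, inv_mul_cancel_right]
  rfl

lemma Nat.exists_mul_modEq_one {a M : ℕ} (hM : M ≠ 0) (ha : a.Coprime M) :
    ∃ b : ℕ, b.Coprime M ∧ b * a ≡ 1 [MOD M] :=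
  Nat.exists_coprime_mul_modEq hM dvd_rfl ha (Nat.coprime_one_left M)

lemma Nat.Coprime.mod_four {a n : ℕ} (ha : a.Coprime (4 * n)) : a % 4 = 1 ∨ a % 4 = 3 := by
  have h : a.Coprime 2 :=
    Nat.Coprime.coprime_dvd_right (Dvd.intro (2 * n) (by ring)) ha
  have := Nat.coprime_two_right.mp h
  grind

lemma ZMod.gcd_val_natCast {n d : ℕ} (hd : d ∣ n) : Nat.gcd ((d : ZMod n)).val n = d := by
  rw [ZMod.val_natCast, (Nat.mod_modEq _ _).gcd_eq, Nat.gcd_eq_left hd]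

section ZMod

variable {n : ℕ} [NeZero n]

lemma ZMod.eq_natCast_gcd_mul (x : ZMod n) :
    ∃ k : ℕ, x.val = Nat.gcd x.val n * k ∧ k.Coprime (n / Nat.gcd x.val n) := by
  have h0 : 0 < Nat.gcd x.val n := Nat.gcd_pos_of_pos_right _ (NeZero.pos n)
  exact ⟨x.val / Nat.gcd x.val n, (Nat.mul_div_cancel' (Nat.gcd_dvd_left _ _)).symm,
    Nat.coprime_div_gcd_div_gcd h0⟩

lemma ZMod.gcd_val_natCast_mul {a : ℕ} (ha : a.Coprime n) (x : ZMod n) :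
    Nat.gcd ((a : ZMod n) * x).val n = Nat.gcd x.val n := by
  have : (a : ZMod n) * x = ((a * x.val : ℕ) : ZMod n) := by simp
  rw [this, ZMod.val_natCast, (Nat.mod_modEq _ _).gcd_eq, Nat.Coprime.gcd_mul_left_cancel _ ha]

/-- Residues with the same gcd with `n` are related by a factor that is coprime to `4 * n`. -/
lemma ZMod.exists_natCast_mul_eq {x y : ZMod n} (h : Nat.gcd x.val n = Nat.gcd y.val n) :
    ∃ a : ℕ, a.Coprime (4 * n) ∧ (a : ZMod n) * x = y := by
  obtain ⟨k, hk, hk'⟩ := ZMod.eq_natCast_gcd_mul x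
  obtain ⟨l, hl, hl'⟩ := ZMod.eq_natCast_gcd_mul y
  rw [← h] at hl hl'
  set d := Nat.gcd x.val n with hd
  have hdn : d ∣ n := Nat.gcd_dvd_right _ _
  obtain ⟨a, ha, hal⟩ := Nat.exists_coprime_mul_modEq (M := 4 * n)
    (by simpa using NeZero.ne n) ((Nat.div_dvd_of_dvd hdn).trans (dvd_mul_left n 4)) hk' hl'
  refine ⟨a, ha, ?_⟩
  have := hal.mul_left' d
  rw [Nat.mul_div_cancel' hdn, ← ZMod.natCast_eq_natCast_iff] at this
  rw [← ZMod.natCast_zmod_val x, ← ZMod.natCast_zmod_val y, hk, hl, ← this]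
  push_cast
  ring

lemma ZMod.mul_modEq_of_natCast_mul_eq {x y : ZMod n} {a d k l : ℕ} (hd : 4 * d ∣ n)
    (h : (a : ZMod n) * x = y) (hx : x.val = d * k) (hy : y.val = d * l) :
    a * k ≡ l [MOD 4] := by
  have hd0 : d ≠ 0 := by
    rintro rfl
    exact NeZero.ne n (by simpa using hd)
  rw [← ZMod.natCast_zmod_val x, ← ZMod.natCast_zmod_val y, hx, hy, ← Nat.cast_mul,
    ZMod.natCast_eq_natCast_iff] at h
  have h' := h.of_dvd hd
  rw [mul_comm 4 d, mul_left_comm] at h'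
  exact Nat.ModEq.mul_left_cancel' hd0 h'

/-- A residue `x` for which `4` does not divide `n / gcd(x, n)` is fixed by a factor that is
coprime to `4 * n` and congruent to `3` modulo `4`. -/
lemma ZMod.exists_natCast_mul_eq_self {x : ZMod n} (h : ¬ 4 ∣ n / Nat.gcd x.val n) :
    ∃ a : ℕ, a.Coprime (4 * n) ∧ a % 4 = 3 ∧ (a : ZMod n) * x = x := by
  obtain ⟨k, hk, -⟩ := ZMod.eq_natCast_gcd_mul x
  set d := Nat.gcd x.val n with hd
  have hdn : d ∣ n := Nat.gcd_dvd_right _ _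
  set m := n / d with hm
  have hmn : m ∣ n := Nat.div_dvd_of_dvd hdn
  -- This makes `a ≡ 3 (mod 4)` and `a ≡ 1 (mod m)` compatible; the second congruence fixes `x`.
  have hg : Nat.gcd 4 m ∣ 2 := by
    have h4 : Nat.gcd 4 m ∣ 4 := Nat.gcd_dvd_left _ _
    have hle := Nat.le_of_dvd (by norm_num) h4
    have hne : Nat.gcd 4 m ≠ 4 := fun h' => h (h' ▸ Nat.gcd_dvd_right 4 m)
    clear_value m
    generalize Nat.gcd 4 m = q at h4 hle hne
    interval_cases q <;> omega
  have hc : 3 ≡ 1 [MOD Nat.gcd 4 m] := (Nat.ModEq.of_dvd hg (by decide : 3 ≡ 1 [MOD 2]))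
  obtain ⟨a₀, ha3, ha1⟩ := Nat.chineseRemainder' hc
  have hcop : a₀.Coprime (Nat.lcm 4 m) := by
    refine Nat.Coprime.coprime_dvd_right (Nat.lcm_dvd_mul 4 m) (Nat.Coprime.mul_right ?_ ?_)
    · rw [Nat.Coprime, ha3.gcd_eq]; decide
    · rw [Nat.Coprime, ha1.gcd_eq]; simp
  have hL : Nat.lcm 4 m ∣ 4 * n := Nat.lcm_dvd (dvd_mul_right _ _) (hmn.trans (dvd_mul_left _ _))
  obtain ⟨a, ha, haa⟩ := Nat.exists_coprime_modEq (by simpa using NeZero.ne n) hL hcop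
  refine ⟨a, ha, (haa.of_dvd (Nat.dvd_lcm_left 4 m)).trans ha3, ?_⟩
  have h1 := ((haa.of_dvd (Nat.dvd_lcm_right 4 m)).trans ha1).mul_left' (d)
  rw [Nat.mul_div_cancel' hdn] at h1
  have h2 := h1.mul_right k
  rw [← ZMod.natCast_eq_natCast_iff] at h2
  rw [← ZMod.natCast_zmod_val x, hk]
  push_cast at h2 ⊢
  linear_combination h2

end ZMod

/-! ### Unit-stable symbol sets as unions of orbits -/

/-- The symmetric and the skew-symmetric part of the symbol set `C` are closed under
multiplication by the integers that are coprime to `n` and congruent to `1` modulo `4`. -/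
def IsUnitStable {n : ℕ} (C : Set (ZMod n)) : Prop :=
  ∀ a : ℕ, a.Coprime (4 * n) → a % 4 = 1 → ∀ x : ZMod n,
    (x ∈ C \ skewPart C → (a : ZMod n) * x ∈ C \ skewPart C) ∧
    (x ∈ skewPart C → (a : ZMod n) * x ∈ skewPart C)

lemma mem_sdiff_skewPart {n : ℕ} {C : Set (ZMod n)} {x : ZMod n} :
    x ∈ C \ skewPart C ↔ x ∈ C ∧ -x ∈ C := by
  simp only [skewPart, Set.mem_sdiff, Set.mem_ofPred_eq]
  tauto

lemma mem_skewPart {n : ℕ} {C : Set (ZMod n)} {x : ZMod n} :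
    x ∈ skewPart C ↔ x ∈ C ∧ -x ∉ C := Iff.rfl

section UnitStable

variable {n : ℕ} [NeZero n] {C : Set (ZMod n)}

lemma exists_natCast_eq_neg {a : ℕ} (ha : a.Coprime (4 * n)) (ha3 : a % 4 = 3) :
    ∃ b : ℕ, b.Coprime (4 * n) ∧ b % 4 = 1 ∧ (b : ZMod n) = -a := by
  have hn : 1 ≤ 4 * n := by have := NeZero.pos n; omega
  -- The factor `4 * n - 1` is `-1` modulo both `4` and `n`.
  refine ⟨(4 * n - 1) * a, Nat.Coprime.mul_left
    ((Nat.coprime_self_sub_left hn).2 (Nat.coprime_one_left _)) ha, ?_, ?_⟩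
  · rw [Nat.mul_mod, ha3]; omega
  · rw [Nat.cast_mul, Nat.cast_sub hn]; simp

/-- Here `-a` acts as a multiplier congruent to `1` modulo `4`; the symmetric part absorbs the sign,
the skew part does not. -/
lemma IsUnitStable.neg_mem (h : IsUnitStable C) {a : ℕ} (ha : a.Coprime (4 * n))
    (ha3 : a % 4 = 3) (x : ZMod n) :
    (x ∈ C \ skewPart C → (a : ZMod n) * x ∈ C \ skewPart C) ∧
    (x ∈ skewPart C → -((a : ZMod n) * x) ∈ skewPart C) := by
  obtain ⟨b, hb, hb1, hcast⟩ := exists_natCast_eq_neg ha ha3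
  have key := h b hb hb1 x
  rw [hcast, neg_mul] at key
  refine ⟨fun hx => ?_, key.2⟩
  have := mem_sdiff_skewPart.1 (key.1 hx)
  rw [neg_neg] at this
  exact mem_sdiff_skewPart.2 this.symm

lemma IsUnitStable.mul_mem_sdiff (h : IsUnitStable C) {a : ℕ} (ha : a.Coprime (4 * n))
    {x : ZMod n} (hx : x ∈ C \ skewPart C) : (a : ZMod n) * x ∈ C \ skewPart C := by
  rcases ha.mod_four with h1 | h3
  · exact (h a ha h1 x).1 hx
  · exact (h.neg_mem ha h3 x).1 hx

lemma IsUnitStable.natCast_mul_mem_iff (h : IsUnitStable C) {a : ℕ} (ha : a.Coprime (4 * n))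
    (ha1 : a % 4 = 1) (x : ZMod n) : (a : ZMod n) * x ∈ C ↔ x ∈ C := by
  have key {b : ℕ} (hb : b.Coprime (4 * n)) (hb1 : b % 4 = 1) {y : ZMod n} (hy : y ∈ C) :
      (b : ZMod n) * y ∈ C := by
    by_cases hy' : -y ∈ C
    · exact ((h b hb hb1 y).1 (mem_sdiff_skewPart.2 ⟨hy, hy'⟩)).1
    · exact ((h b hb hb1 y).2 ⟨hy, hy'⟩).1
  refine ⟨fun hx => ?_, key ha ha1⟩
  obtain ⟨b, hb, hba⟩ := Nat.exists_mul_modEq_one (by simpa using NeZero.ne n) ha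
  have hb1 : b % 4 = 1 := by
    have h4 : b * a % 4 = 1 := hba.of_dvd (dvd_mul_right 4 n)
    rwa [Nat.mul_mod, ha1, mul_one, Nat.mod_mod] at h4
  have hban := hba.of_dvd (dvd_mul_left n 4)
  rw [← ZMod.natCast_eq_natCast_iff, Nat.cast_mul, Nat.cast_one] at hban
  simpa [← mul_assoc, hban] using key hb hb1 hx

/-- Otherwise some `a ≡ 3 (mod 4)` fixes `x`, and stability puts `-x` in `C`. -/
lemma IsUnitStable.four_dvd (h : IsUnitStable C) {x : ZMod n} (hx : x ∈ skewPart C) :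
    4 ∣ n / Nat.gcd x.val n := by
  by_contra hnd
  obtain ⟨a, ha, ha3, hax⟩ := ZMod.exists_natCast_mul_eq_self hnd
  have := (h.neg_mem ha ha3 x).2 hx
  rw [hax] at this
  exact hx.2 this.1

lemma mem_gcdClassMod_natCast_mul {d r a : ℕ} (hd : 4 * d ∣ n) (ha : a.Coprime (4 * n))
    (ha1 : a % 4 = 1) {x : ZMod n} (hx : x ∈ gcdClassMod n d r) :
    (a : ZMod n) * x ∈ gcdClassMod n d r := by
  obtain ⟨k, hk, hkr, hg⟩ := hx
  rw [← hk] at hg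
  have hg' := (ZMod.gcd_val_natCast_mul (ha.coprime_mul_left_right) x).trans hg
  obtain ⟨l, hl, -⟩ := ZMod.eq_natCast_gcd_mul ((a : ZMod n) * x)
  rw [hg'] at hl
  refine ⟨l, hl, ?_, hl ▸ hg'⟩
  have h1 := ZMod.mul_modEq_of_natCast_mul_eq hd rfl hk hl
  have h2 : a * k ≡ 1 * k [MOD 4] := Nat.ModEq.mul_right k (by simpa [Nat.ModEq] using ha1)
  rw [one_mul] at h2
  exact h1.symm.trans (h2.trans hkr)

lemma gcdClass_natCast_mul {d a : ℕ} (ha : a.Coprime n) {x : ZMod n} (hx : x ∈ gcdClass n d) :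
    (a : ZMod n) * x ∈ gcdClass n d := by
  obtain ⟨h1, h2, h3⟩ := hx
  have hg := (ZMod.gcd_val_natCast_mul ha x).trans h3
  refine ⟨?_, Nat.le_sub_one_of_lt (ZMod.val_lt _), hg⟩
  -- A zero product would give `d = n`, but `d` divides `x.val`, which lies strictly between `0` and
  -- `n`.
  by_contra h0
  rw [Nat.lt_one_iff.mp (not_le.mp h0), Nat.gcd_zero_left] at hg
  have hle := Nat.le_of_dvd h1 (Nat.gcd_dvd_left x.val n)
  have hlt := ZMod.val_lt x
  omega

lemma mem_gcdClass_of_ne_zero {x : ZMod n} (hx : x ≠ 0) : x ∈ gcdClass n (Nat.gcd x.val n) :=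
  ⟨Nat.one_le_iff_ne_zero.2 (by simpa using hx), Nat.le_sub_one_of_lt (ZMod.val_lt _), rfl⟩

lemma natCast_mem_gcdClassMod_one {d : ℕ} (hd : 4 * d ∣ n) : (d : ZMod n) ∈ gcdClassMod n d 1 := by
  have hlt : d < n := by
    have := Nat.le_of_dvd (NeZero.pos n) hd
    have : d ≠ 0 := by rintro rfl; exact NeZero.ne n (by simpa using hd)
    omega
  refine ⟨1, ?_, rfl, ?_⟩
  · rw [ZMod.val_natCast, Nat.mod_eq_of_lt hlt, mul_one]
  · rw [mul_one, Nat.gcd_eq_left ((dvd_mul_left d 4).trans hd)]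

lemma neg_natCast_mem_gcdClassMod_three {d : ℕ} (hd : 4 * d ∣ n) :
    -(d : ZMod n) ∈ gcdClassMod n d 3 := by
  obtain ⟨m, hm⟩ := hd
  have hn := NeZero.ne n
  have hd0 : 0 < d := Nat.pos_of_ne_zero (by rintro rfl; simp_all)
  have hm0 : 0 < m := Nat.pos_of_ne_zero (by rintro rfl; simp_all)
  have hk : n - d = d * (4 * m - 1) := by
    rw [hm, Nat.mul_sub, mul_one]; congr 1; ring
  have hdn : d < n := by rw [hm]; nlinarith
  refine ⟨4 * m - 1, ?_, ?_, ?_⟩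
  · rw [← hk, ZMod.neg_val, ZMod.val_natCast, Nat.mod_eq_of_lt hdn, if_neg]
    rw [← ZMod.val_eq_zero, ZMod.val_natCast, Nat.mod_eq_of_lt hdn]
    exact hd0.ne'
  · simp only [Nat.ModEq]; omega
  · rw [← hk, Nat.gcd_self_sub_left hdn.le, Nat.gcd_eq_left]
    exact hm ▸ ⟨4 * m, by ring⟩

/-- Elements of the same class `gcdClassMod n d r` are related by a factor that is coprime to
`4 * n` and congruent to `1` modulo `4`. -/
lemma exists_natCast_mul_eq_of_mem_gcdClassMod {d r : ℕ} (hr : r = 1 ∨ r = 3) (hd : 4 * d ∣ n)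
    {x y : ZMod n} (hx : x ∈ gcdClassMod n d r) (hy : y ∈ gcdClassMod n d r) :
    ∃ a : ℕ, a.Coprime (4 * n) ∧ a % 4 = 1 ∧ (a : ZMod n) * x = y := by
  obtain ⟨k, hk, hkr, hgx⟩ := hx
  obtain ⟨l, hl, hlr, hgy⟩ := hy
  obtain ⟨a, ha, hax⟩ := ZMod.exists_natCast_mul_eq (x := x) (y := y)
    (by rw [hk, hl, hgx, hgy])
  refine ⟨a, ha, ?_, hax⟩
  have h := ZMod.mul_modEq_of_natCast_mul_eq hd hax hk hl
  have h' : a * r ≡ r [MOD 4] := (hkr.symm.mul_left a).trans (h.trans hlr)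
  simp only [Nat.ModEq] at h'
  rcases hr with rfl | rfl <;> omega

lemma gcdClassMod_subset_skewPart (h : IsUnitStable C) {d r : ℕ} (hr : r = 1 ∨ r = 3)
    (hd : 4 * d ∣ n) {x : ZMod n} (hx : x ∈ gcdClassMod n d r) (hxC : x ∈ skewPart C) :
    gcdClassMod n d r ⊆ skewPart C := by
  intro y hy
  obtain ⟨a, ha, ha1, rfl⟩ := exists_natCast_mul_eq_of_mem_gcdClassMod hr hd hx hy
  exact (h a ha ha1 x).2 hxC

lemma exists_mem_gcdClassMod {x : ZMod n} (hx : 4 ∣ n / Nat.gcd x.val n) :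
    x ∈ gcdClassMod n (Nat.gcd x.val n) 1 ∨ x ∈ gcdClassMod n (Nat.gcd x.val n) 3 := by
  obtain ⟨k, hk, hc⟩ := ZMod.eq_natCast_gcd_mul x
  have h4 : k.Coprime (4 * 1) := by simpa using Nat.Coprime.coprime_dvd_right hx hc
  have hg : Nat.gcd (Nat.gcd x.val n * k) n = Nat.gcd x.val n := by rw [← hk]
  exact h4.mod_four.imp (fun h => ⟨k, hk, h, hg⟩) (fun h => ⟨k, hk, h, hg⟩)

open Classical in
-- The divisor `d` itself represents its gcd class, a single orbit, so testing `d` decides the whole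
-- class.
lemma IsUnitStable.sdiff_skewPart_eq (h : IsUnitStable C) (hC : (0 : ZMod n) ∉ C) :
    C \ skewPart C = ⋃ d ∈ n.divisors.filter (fun d : ℕ => (d : ZMod n) ∈ C \ skewPart C),
      gcdClass n d := by
  ext x
  simp only [Set.mem_iUnion, Finset.mem_filter, Nat.mem_divisors, exists_prop]
  constructor
  · intro hx
    have hx0 : x ≠ 0 := by rintro rfl; exact hC hx.1
    have hdn := Nat.gcd_dvd_right x.val n
    refine ⟨Nat.gcd x.val n, ⟨⟨hdn, NeZero.ne n⟩, ?_⟩, mem_gcdClass_of_ne_zero hx0⟩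
    obtain ⟨a, ha, hax⟩ := ZMod.exists_natCast_mul_eq (x := x)
      (y := ((Nat.gcd x.val n : ℕ) : ZMod n)) (ZMod.gcd_val_natCast hdn).symm
    exact hax ▸ h.mul_mem_sdiff ha hx
  · rintro ⟨d, ⟨⟨hdn, -⟩, hd⟩, -, -, hx⟩
    obtain ⟨a, ha, hax⟩ := ZMod.exists_natCast_mul_eq (x := (d : ZMod n)) (y := x)
      ((ZMod.gcd_val_natCast hdn).trans hx.symm)
    exact hax ▸ h.mul_mem_sdiff ha hd

open Classical in
-- The residues `d` and `-d` represent the two halves of a gcd class; they cannot both be skew.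
lemma IsUnitStable.skewPart_eq (h : IsUnitStable C) (h4 : 4 ∣ n) :
    skewPart C = ⋃ d ∈ (n / 4).divisors.filter
        (fun d : ℕ => (d : ZMod n) ∈ skewPart C ∨ -(d : ZMod n) ∈ skewPart C),
      if (d : ZMod n) ∈ skewPart C then gcdClassMod n d 1 else gcdClassMod n d 3 := by
  ext x
  simp only [Set.mem_iUnion, Finset.mem_filter, Nat.mem_divisors, exists_prop]
  constructor
  · intro hx
    have hdvd := h.four_dvd hx
    set d := Nat.gcd x.val n with hd
    have hdn : d ∣ n := Nat.gcd_dvd_right x.val n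
    have h4d : 4 * d ∣ n := by
      obtain ⟨e, he⟩ := hdvd
      exact ⟨e, by rw [← Nat.div_mul_cancel hdn, he]; ring⟩
    have hd4 : d ∣ n / 4 := Nat.dvd_div_of_mul_dvd h4d
    have hn4 : n / 4 ≠ 0 := by
      have := NeZero.ne n; omega
    rcases exists_mem_gcdClassMod hdvd with hx1 | hx3
    · have hdC := gcdClassMod_subset_skewPart h (.inl rfl) h4d hx1 hx
        (natCast_mem_gcdClassMod_one h4d)
      exact ⟨d, ⟨⟨hd4, hn4⟩, .inl hdC⟩, by rwa [if_pos hdC]⟩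
    · have hdC := gcdClassMod_subset_skewPart h (.inr rfl) h4d hx3 hx
        (neg_natCast_mem_gcdClassMod_three h4d)
      refine ⟨d, ⟨⟨hd4, hn4⟩, .inr hdC⟩, ?_⟩
      rwa [if_neg]
      exact fun hdC' => hdC.2 (by simpa using hdC'.1)
  · rintro ⟨d, ⟨⟨hdn, -⟩, hd⟩, hx⟩
    have h4d : 4 * d ∣ n := by
      obtain ⟨e, he⟩ := hdn
      exact ⟨e, by rw [← Nat.mul_div_cancel' h4, he]; ring⟩
    split_ifs at hx with hdC
    · exact gcdClassMod_subset_skewPart h (.inl rfl) h4d (natCast_mem_gcdClassMod_one h4d) hdC hx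
    · exact gcdClassMod_subset_skewPart h (.inr rfl) h4d (neg_natCast_mem_gcdClassMod_three h4d)
        (hd.resolve_left hdC) hx

theorem isUnitStable_iff (hC : (0 : ZMod n) ∉ C) :
    IsUnitStable C ↔
      ∃ D₁ : Finset ℕ, D₁ ⊆ n.divisors ∧
        C \ skewPart C = (⋃ d ∈ D₁, gcdClass n d) ∧
        (¬ 4 ∣ n → skewPart C = ∅) ∧
        (4 ∣ n → ∃ (D₂ : Finset ℕ) (S : ℕ → Set (ZMod n)),
          D₂ ⊆ (n / 4).divisors ∧ Disjoint D₁ D₂ ∧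
          (∀ d ∈ D₂, S d = gcdClassMod n d 1 ∨ S d = gcdClassMod n d 3) ∧
          skewPart C = ⋃ d ∈ D₂, S d) := by
  classical
  constructor
  · intro h
    refine ⟨_, Finset.filter_subset _ _, h.sdiff_skewPart_eq hC, fun h4 => ?_,
      fun h4 => ⟨_, fun d => if (d : ZMod n) ∈ skewPart C then gcdClassMod n d 1
        else gcdClassMod n d 3, Finset.filter_subset _ _, ?_, fun d _ => ?_, h.skewPart_eq h4⟩⟩
    · refine Set.eq_empty_iff_forall_notMem.2 fun x hx => h4 ?_
      exact (h.four_dvd hx).trans (Nat.div_dvd_of_dvd (Nat.gcd_dvd_right _ _))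
    · rw [Finset.disjoint_left]
      intro d hd1 hd2
      have h1 := mem_sdiff_skewPart.1 (Finset.mem_filter.1 hd1).2
      rcases (Finset.mem_filter.1 hd2).2 with h2 | h2
      · exact h2.2 h1.2
      · exact h2.2 (by simpa using h1.1)
    · dsimp only
      split_ifs
      · exact .inl rfl
      · exact .inr rfl
  · rintro ⟨D₁, -, hsym, h0, h4⟩ a ha ha1 x
    refine ⟨fun hx => ?_, fun hx => ?_⟩
    · rw [hsym] at hx ⊢
      simp only [Set.mem_iUnion, exists_prop] at hx ⊢
      obtain ⟨d, hd, hx⟩ := hx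
      exact ⟨d, hd, gcdClass_natCast_mul ha.coprime_mul_left_right hx⟩
    · by_cases hn : 4 ∣ n
      · obtain ⟨D₂, S, hD₂, -, hS, hskew⟩ := h4 hn
        rw [hskew] at hx ⊢
        simp only [Set.mem_iUnion, exists_prop] at hx ⊢
        obtain ⟨d, hd, hx⟩ := hx
        refine ⟨d, hd, ?_⟩
        have h4d : 4 * d ∣ n := by
          obtain ⟨e, he⟩ := Nat.dvd_of_mem_divisors (hD₂ hd)
          exact ⟨e, by rw [← Nat.mul_div_cancel' hn, he]; ring⟩
        rcases hS d hd with hSd | hSd <;> rw [hSd] at hx ⊢ <;>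
          exact mem_gcdClassMod_natCast_mul h4d ha ha1 hx
      · rw [h0 hn] at hx
        exact hx.elim

end UnitStable

/-! ### Fourier transform and Galois action -/

section IntegralCirculant

open Polynomial ZMod

/-- An integral polynomial expression in a primitive root of unity is an integer if and only if
its conjugates coincide. -/
theorem IsPrimitiveRoot.exists_aeval_eq_intCast_iff {N : ℕ} [NeZero N] {ζ : ℂ}
    (hζ : IsPrimitiveRoot ζ N) (p : ℤ[X]) :
    (∃ z : ℤ, aeval ζ p = (z : ℂ)) ↔ ∀ a : ℕ, a.Coprime N → aeval (ζ ^ a) p = aeval ζ p := by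
  constructor
  · rintro ⟨z, hz⟩ a ha
    have h0 : aeval ζ (p - C z) = 0 := by simp [hz]
    have hdvd := minpoly.isIntegrallyClosed_dvd (hζ.isIntegral (NeZero.pos N)) h0
    -- Conjugate roots share a minimal polynomial, so `p - z` also vanishes at `ζ ^ a`.
    rw [hζ.minpoly_eq_pow_coprime ha] at hdvd
    obtain ⟨q, hq⟩ := hdvd
    have h1 : aeval (ζ ^ a) (p - C z) = 0 := by rw [hq, map_mul, minpoly.aeval, zero_mul]
    rw [map_sub, sub_eq_zero] at h1
    rw [h1, hz]
    simp
  · intro h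
    let K := IntermediateField.adjoin ℚ {ζ}
    have : IsCyclotomicExtension {N} ℚ K := by
      change IsCyclotomicExtension {N} ℚ (IntermediateField.adjoin ℚ {ζ}).toSubalgebra
      rw [IntermediateField.adjoin_simple_toSubalgebra_of_isAlgebraic
        (hζ.isIntegral (NeZero.pos N)).tower_top.isAlgebraic]
      exact hζ.adjoin_isCyclotomicExtension ℚ
    have : FiniteDimensional ℚ K := IsCyclotomicExtension.finiteDimensional {N} ℚ K
    have : IsGalois ℚ K := IsCyclotomicExtension.isGalois {N} ℚ K
    let ξ : K := ⟨ζ, IntermediateField.mem_adjoin_simple_self ℚ ζ⟩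
    have hξ : IsPrimitiveRoot ξ N :=
      IsPrimitiveRoot.of_map_of_injective (f := algebraMap K ℂ) hζ (algebraMap K ℂ).injective
    have hcoe (y : K) : algebraMap K ℂ (aeval y p) = aeval (algebraMap K ℂ y) p :=
      (aeval_algebraMap_apply ℂ y p).symm
    have hbot : aeval ξ p ∈ (⊥ : IntermediateField ℚ K) := by
      rw [IsGalois.mem_bot_iff_fixed]
      intro σ
      have hσ : σ (aeval ξ p) = aeval (σ ξ) p :=
        (aeval_algHom_apply (σ.toAlgHom.restrictScalars ℤ) ξ p).symm
      apply (algebraMap K ℂ).injective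
      rw [hσ, ← hξ.autToPow_spec ℚ σ, hcoe, hcoe, map_pow]
      exact h _ (ZMod.val_coe_unit_coprime _)
    obtain ⟨q, hq⟩ := IntermediateField.mem_bot.1 hbot
    -- A Galois-fixed value is rational; being also an algebraic integer, it lies in `ℤ`.
    have hint : IsIntegral ℤ q := by
      rw [← isIntegral_algebraMap_iff (algebraMap ℚ K).injective, hq]
      exact adjoin_le_integralClosure (hξ.isIntegral (NeZero.pos N))
        (aeval_mem_adjoin_singleton ℤ ξ)
    obtain ⟨z, rfl⟩ := IsIntegrallyClosed.isIntegral_iff.1 hint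
    refine ⟨z, ?_⟩
    have := congrArg (algebraMap K ℂ) hq
    rw [hcoe] at this
    exact this.symm.trans (by simp)

/-- The entry `h_{0k}` of the Hermitian adjacency matrix of `Circ(ℤ_n, C)`, where `t` stands for
the imaginary unit. -/
noncomputable def circulantSymbol {n : ℕ} {R : Type*} [Ring R] (t : R) (C : Set (ZMod n))
    (k : ZMod n) : R :=
  open Classical in
  if k ∈ C ∧ -k ∈ C then 1
    else if k ∈ C ∧ -k ∉ C then t
    else if k ∉ C ∧ -k ∈ C then -t
    else 0

/-- Lets the symbol over `ℤ[X]` with `t = X ^ n` specialize to `t = I ^ a`. -/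
lemma map_circulantSymbol {n : ℕ} {R S F : Type*} [Ring R] [Ring S] [FunLike F R S]
    [RingHomClass F R S] (φ : F) (t : R) (C : Set (ZMod n)) (k : ZMod n) :
    φ (circulantSymbol t C k) = circulantSymbol (φ t) C k := by
  unfold circulantSymbol
  split_ifs <;> simp

lemma circulantSymbol_neg {n : ℕ} {R : Type*} [Ring R] (t : R) (C : Set (ZMod n)) (k : ZMod n) :
    circulantSymbol t C (-k) = circulantSymbol (-t) C k := by
  unfold circulantSymbol
  simp only [neg_neg]
  by_cases h1 : k ∈ C <;> by_cases h2 : -k ∈ C <;> simp [h1, h2]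

lemma circulantSymbol_eq_one_iff {n : ℕ} (C : Set (ZMod n)) (k : ZMod n) :
    circulantSymbol Complex.I C k = 1 ↔ k ∈ C \ skewPart C := by
  have h1 : Complex.I ≠ 1 := fun h => by simpa using congrArg Complex.re h
  have h2 : -Complex.I ≠ 1 := fun h => by simpa using congrArg Complex.re h
  rw [mem_sdiff_skewPart]
  unfold circulantSymbol
  split_ifs <;> simp_all

lemma circulantSymbol_eq_I_iff {n : ℕ} (C : Set (ZMod n)) (k : ZMod n) :
    circulantSymbol Complex.I C k = Complex.I ↔ k ∈ skewPart C := by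
  have h1 : 1 ≠ Complex.I := fun h => by simpa using congrArg Complex.re h
  have h2 : -Complex.I ≠ Complex.I := neg_ne_self.2 Complex.I_ne_zero
  have h3 : 0 ≠ Complex.I := Complex.I_ne_zero.symm
  rw [mem_skewPart]
  unfold circulantSymbol
  split_ifs <;> simp_all

lemma hermitianAdjMatrix_circ_apply {n : ℕ} {C : Set (ZMod n)} (hC : (0 : ZMod n) ∉ C)
    (u v : ZMod n) :
    (MixedGraph.circ n C hC).hermitianAdjMatrix u v = circulantSymbol Complex.I C (v - u) := by
  simp only [MixedGraph.hermitianAdjMatrix, MixedGraph.circ, circulantSymbol, Matrix.of_apply]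
  by_cases h1 : v - u ∈ C <;> by_cases h2 : u - v ∈ C <;> simp [h1, h2]

variable {n : ℕ} [NeZero n] {C : Set (ZMod n)}

/-- The eigenvalues of a circulant Hermitian adjacency matrix are the values of the discrete
Fourier transform of its first row. -/
theorem hasEigenvalue_circ_iff (hC : (0 : ZMod n) ∉ C) (μ : ℂ) :
    Module.End.HasEigenvalue (Matrix.toLin' (MixedGraph.circ n C hC).hermitianAdjMatrix) μ ↔
      ∃ j : ZMod n, dft (circulantSymbol Complex.I C) j = μ := by
  have happ (v : ZMod n → ℂ) (u : ZMod n) :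
      Matrix.toLin' (MixedGraph.circ n C hC).hermitianAdjMatrix v u =
        ∑ k, circulantSymbol Complex.I C k * v (u + k) := by
    rw [Matrix.toLin'_apply, Matrix.mulVec, dotProduct,
      ← Equiv.sum_comp (Equiv.addLeft u)]
    simp [hermitianAdjMatrix_circ_apply]
  constructor
  · intro h
    obtain ⟨v, hv⟩ := h.exists_hasEigenvector
    have hne : dft v ≠ 0 := by simpa using hv.2
    obtain ⟨j, hj⟩ := Function.ne_iff.1 hne
    -- The matrix acts by `v (u + k)`, a correlation, not a convolution; hence the sign of the
    -- frequency.
    refine ⟨-j, mul_right_cancel₀ hj ?_⟩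
    have hdft := congrFun (congrArg dft hv.apply_eq_smul) j
    rw [_root_.map_smul, Pi.smul_apply, smul_eq_mul] at hdft
    rw [← hdft, dft_apply (Matrix.toLin' _ v)]
    simp only [happ, smul_eq_mul, Finset.mul_sum]
    rw [Finset.sum_comm, dft_apply, Finset.sum_mul]
    refine Finset.sum_congr rfl fun k _ => ?_
    rw [dft_apply, Finset.mul_sum, ← Equiv.sum_comp (Equiv.addRight k)]
    refine Finset.sum_congr rfl fun u _ => ?_
    have : -((u + k) * j) = -(u * j) + -(k * j) := by ring
    simp only [Equiv.coe_addRight, smul_eq_mul, this, AddChar.map_add_eq_mul]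
    have h1 : stdAddChar (-(k * -j)) * stdAddChar (-(k * j)) = (1 : ℂ) := by
      rw [← AddChar.map_add_eq_mul]; simp
    linear_combination (stdAddChar (-(u * j)) * circulantSymbol Complex.I C k * v (u + k)) * h1
  · rintro ⟨j, rfl⟩
    refine Module.End.hasEigenvalue_of_hasEigenvector (x := fun u => stdAddChar (-(u * j))) ⟨?_, ?_⟩
    · rw [Module.End.mem_eigenspace_iff]
      ext u
      rw [happ, Pi.smul_apply, dft_apply, smul_eq_mul, Finset.sum_mul]
      refine Finset.sum_congr rfl fun k _ => ?_
      have : -((u + k) * j) = -(k * j) + -(u * j) := by ring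
      rw [this, AddChar.map_add_eq_mul, smul_eq_mul]
      ring
    · intro h
      simpa using congrFun h 0

theorem isIntegral_circ_iff (hC : (0 : ZMod n) ∉ C) :
    (MixedGraph.circ n C hC).IsIntegral ↔
      ∀ j : ZMod n, ∃ z : ℤ, dft (circulantSymbol Complex.I C) j = (z : ℂ) := by
  simp only [MixedGraph.IsIntegral, hasEigenvalue_circ_iff]
  exact ⟨fun h j => h _ ⟨j, rfl⟩, fun h μ ⟨j, hj⟩ => hj ▸ h j⟩

/-- The values of the discrete Fourier transform of the symbol as polynomials in a primitive
`4 * n`-th root of unity. -/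
noncomputable def dftPolynomial (C : Set (ZMod n)) (j : ZMod n) : ℤ[X] :=
  ∑ k : ZMod n, X ^ (4 * (-(k * j)).val) * circulantSymbol (X ^ n) C k

lemma aeval_pow_dftPolynomial {ζ : ℂ} (hω : ζ ^ 4 = stdAddChar (1 : ZMod n))
    (hI : ζ ^ n = Complex.I) (a : ℕ) (j : ZMod n) :
    aeval (ζ ^ a) (dftPolynomial C j) =
      ∑ k : ZMod n, stdAddChar (-((a * k : ZMod n) * j)) * circulantSymbol (Complex.I ^ a) C k := by
  have hpow (x : ZMod n) : ζ ^ (4 * x.val) = stdAddChar x := by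
    rw [pow_mul, hω, ← AddChar.map_nsmul_eq_pow, nsmul_one, natCast_zmod_val]
  rw [dftPolynomial, map_sum]
  refine Finset.sum_congr rfl fun k _ => ?_
  rw [map_mul, map_circulantSymbol, map_pow, map_pow, aeval_X, ← pow_mul, ← pow_mul, mul_comm a,
    mul_comm a, pow_mul, hpow, pow_mul, hI, ← AddChar.map_nsmul_eq_pow]
  congr 2
  rw [nsmul_eq_mul]; ring

lemma exists_isPrimitiveRoot_four_mul (n : ℕ) [NeZero n] :
    ∃ ζ : ℂ, IsPrimitiveRoot ζ (4 * n) ∧ ζ ^ 4 = stdAddChar (1 : ZMod n) ∧ ζ ^ n = Complex.I := by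
  have hn : (n : ℂ) ≠ 0 := Nat.cast_ne_zero.2 (NeZero.ne n)
  refine ⟨_, Complex.isPrimitiveRoot_exp (4 * n) (by simpa using NeZero.ne n), ?_, ?_⟩
  · have := stdAddChar_coe (N := n) 1
    rw [Int.cast_one] at this
    rw [this, ← Complex.exp_nat_mul]
    congr 1
    push_cast
    field_simp
  · rw [← Complex.exp_nat_mul]
    refine Eq.trans ?_ Complex.exp_pi_div_two_mul_I
    congr 1
    push_cast
    field_simp
    norm_num

/-- A mixed circulant graph is integral if and only if its symbol is equivariant under the
Galois action. -/
theorem isIntegral_circ_iff_equivariant (hC : (0 : ZMod n) ∉ C) :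
    (MixedGraph.circ n C hC).IsIntegral ↔ ∀ a : ℕ, a.Coprime (4 * n) → ∀ k : ZMod n,
      circulantSymbol (Complex.I ^ a) C k = circulantSymbol Complex.I C (a * k) := by
  obtain ⟨ζ, hζ, hω, hI⟩ := exists_isPrimitiveRoot_four_mul n
  have haeval (j : ZMod n) : dft (circulantSymbol Complex.I C) j = aeval ζ (dftPolynomial C j) := by
    simpa [dft_apply] using (aeval_pow_dftPolynomial (C := C) hω hI 1 j).symm
  have hN : NeZero (4 * n) := ⟨by simpa using NeZero.ne n⟩
  simp only [isIntegral_circ_iff, haeval, hζ.exists_aeval_eq_intCast_iff]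
  rw [forall_comm]
  refine forall_congr' fun a => ?_
  rw [forall_comm]
  refine forall_congr' fun ha => ?_
  let u := ZMod.unitOfCoprime a (Nat.Coprime.coprime_mul_left_right ha)
  have hu : (u : ZMod n) = a := rfl
  have hsum (j : ZMod n) : aeval (ζ ^ a) (dftPolynomial C j) =
      dft (fun k => circulantSymbol (Complex.I ^ a) C (((u⁻¹ : (ZMod n)ˣ) : ZMod n) * k)) j := by
    rw [aeval_pow_dftPolynomial hω hI, dft_apply]
    refine Eq.trans ?_ (Equiv.sum_comp u.mulLeft _)
    simp [← hu]
  simp only [hsum, ← haeval]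
  -- All frequencies together determine the symbol, so invariance of every eigenvalue can be read
  -- off entrywise.
  rw [← funext_iff, dft.injective.eq_iff, funext_iff, ← u.mulLeft.forall_congr_right]
  simp [← hu]

theorem isIntegral_circ_iff_isUnitStable (hC : (0 : ZMod n) ∉ C) :
    (MixedGraph.circ n C hC).IsIntegral ↔ IsUnitStable C := by
  rw [isIntegral_circ_iff_equivariant]
  have hpow {a : ℕ} (ha : a % 4 = 1) : Complex.I ^ a = Complex.I := by
    rw [Complex.I_pow_eq_pow_mod, ha, pow_one]
  have hpow3 {a : ℕ} (ha : a % 4 = 3) : Complex.I ^ a = -Complex.I := by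
    rw [Complex.I_pow_eq_pow_mod, ha, Complex.I_pow_three]
  constructor
  · intro h a ha ha1 x
    have := h a ha x
    rw [hpow ha1] at this
    simp only [← circulantSymbol_eq_one_iff, ← circulantSymbol_eq_I_iff, this]
    simp
  · intro h
    have key {a : ℕ} (ha : a.Coprime (4 * n)) (ha1 : a % 4 = 1) (k : ZMod n) :
        circulantSymbol Complex.I C k = circulantSymbol Complex.I C (a * k) := by
      have hk := h.natCast_mul_mem_iff ha ha1 k
      have hk' := h.natCast_mul_mem_iff ha ha1 (-k)
      rw [mul_neg] at hk'
      unfold circulantSymbol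
      by_cases h1 : k ∈ C <;> by_cases h2 : -k ∈ C <;> simp [h1, h2, hk, hk']
    intro a ha k
    rcases ha.mod_four with ha1 | ha3
    · rw [hpow ha1, key ha ha1]
    · obtain ⟨b, hb, hb1, hba⟩ := exists_natCast_eq_neg ha ha3
      rw [hpow3 ha3, ← circulantSymbol_neg, key hb hb1, hba, neg_mul_neg]

end IntegralCirculant

theorem theorem5p4 (n : ℕ) [NeZero n] (C : Set (ZMod n)) (hC : (0 : ZMod n) ∉ C) :
    (MixedGraph.circ n C hC).IsIntegral ↔
      ∃ D₁ : Finset ℕ, D₁ ⊆ n.divisors ∧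
        C \ skewPart C = (⋃ d ∈ D₁, gcdClass n d) ∧
        (¬ 4 ∣ n → skewPart C = ∅) ∧
        (4 ∣ n → ∃ (D₂ : Finset ℕ) (S : ℕ → Set (ZMod n)),
          D₂ ⊆ (n / 4).divisors ∧ Disjoint D₁ D₂ ∧
          (∀ d ∈ D₂, S d = gcdClassMod n d 1 ∨ S d = gcdClassMod n d 3) ∧
          skewPart C = ⋃ d ∈ D₂, S d) :=
  (isIntegral_circ_iff_isUnitStable hC).trans (isUnitStable_iff hC)
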